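/- Let $K$ be a field and let $S=\bigoplus_{n\ge 0}S_n$ be a standard graded $K$-algebra, i.e. a commutative graded $K$-algebra, finitely generated over $K$, with $S_0=K$ and $S=K[S_1]$. Let $M=\bigoplus_{n\ge 0}M_n$ be a nonzero finitely generated graded $S$-module of Krull dimension $m=\dim M\ge 0$. Put $H(M,n)=\dim_K M_n$, and let $h_M(t)\in\mathbb Z[t]$ be the polynomial with $$\sum_{n\ge 0}H(M,n)t^n=\frac{h_M(t)}{(1-t)^m};$$ the multiplicity of $M$ is $e(M):=h_M(1)$. Let $H_1(M,n)=\sum_{j=0}^{n}H(M,j)$ be the first iterated Hilbert function of $M$. For real $w>0$ and $\operatorname{Re} z>m+1$ the series $$\zeta^1_M(z,w)=\sum_{n\ge 0}\frac{H_1(M,n)}{(n+w)^z}$$ converges absolutely, the limit $$\zeta^1_M(z)=\lim_{w\searrow 0}\bigl(\zeta^1_M(z,w)-H(M,0)\,w^{-z}\bigr)$$ exists for $\operatorname{Re} z>m+1$, and the function $\zeta^1_M$ extends to a meromorphic function on $\mathbb C$. If $R^1_M(m+1)$ denotes the residue of this meromorphic function at $z=m+1$, then $$e(M)=m!\,R^1_M(m+1).$$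 -/

import Mathlib

noncomputable section

namespace GradedZeta

/-- A (commutative) graded `K`-algebra `S = ⨁ₙ Sₙ` is *standard graded* if `S₀ = K`, `S` is
generated as a `K`-algebra by `S₁`, and `S` is finitely generated over `K`.
(`1 : Submodule K S` is the image of `K` in `S`.) -/
structure IsStandardGraded {K S : Type*} [Field K] [CommRing S] [Algebra K S]
    (𝒮 : ℕ → Submodule K S) : Prop where
  zero_eq : 𝒮 0 = 1
  adjoin_one : Algebra.adjoin K (𝒮 1 : Set S) = ⊤
  finiteType : Algebra.FiniteType K S

section HilbertFunction

variable {K M : Type*} [Field K] [AddCommGroup M] [Module K M]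

/-- The Hilbert function `H(M, n) = dim_K Mₙ`. -/
def hilbertFunction (𝓜 : ℕ → Submodule K M) (n : ℕ) : ℕ :=
  Module.finrank K (𝓜 n)

/-- The Hilbert series `H_M(t) = ∑ₙ H(M, n) tⁿ` in `ℤ⟦t⟧`. -/
def hilbertSeries (𝓜 : ℕ → Submodule K M) : PowerSeries ℤ :=
  PowerSeries.mk fun n => (hilbertFunction 𝓜 n : ℤ)

/-- `h` is the numerator of the Hilbert series written with denominator `(1 - t) ^ m`, that is
`H_M(t) = h(t) / (1 - t) ^ m`. At most one polynomial `h` has this property. -/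
def IsHilbertNumerator (𝓜 : ℕ → Submodule K M) (m : ℕ) (h : Polynomial ℤ) : Prop :=
  (h : PowerSeries ℤ) = hilbertSeries 𝓜 * (1 - PowerSeries.X) ^ m

open Classical in
/-- The numerator `h_M(t) ∈ ℤ[t]` of the Hilbert series of a graded module of dimension `m`. -/
def hilbertNumerator (𝓜 : ℕ → Submodule K M) (m : ℕ) : Polynomial ℤ :=
  if h : ∃ h : Polynomial ℤ, IsHilbertNumerator 𝓜 m h then h.choose else 0

/-- The multiplicity `e(M) = h_M(1)` of a graded module of dimension `m`. -/
def multiplicity (𝓜 : ℕ → Submodule K M) (m : ℕ) : ℤ :=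
  (hilbertNumerator 𝓜 m).eval 1

/-- The higher iterated Hilbert functions: `H₀(M, n) = H(M, n)` and
`Hᵢ₊₁(M, n) = ∑_{j = 0}^{n} Hᵢ(M, j)`. -/
def iteratedHilbertFunction (𝓜 : ℕ → Submodule K M) : ℕ → ℕ → ℕ
  | 0, n => hilbertFunction 𝓜 n
  | i + 1, n => ∑ j ∈ Finset.range (n + 1), iteratedHilbertFunction 𝓜 i j

/-- The `n`-th term `Hᵢ(M, n) / (n + w) ^ z` of the `i`-th Zeta-Barnes type series. -/
def zetaBarnesTerm (𝓜 : ℕ → Submodule K M) (i : ℕ) (z : ℂ) (w : ℝ) (n : ℕ) : ℂ :=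
  (iteratedHilbertFunction 𝓜 i n : ℂ) / ((n : ℂ) + (w : ℂ)) ^ z

/-- The sum `ζⁱ_M(z, w) = ∑_{n ≥ 0} Hᵢ(M, n) / (n + w) ^ z` of the `i`-th Zeta-Barnes type series
(for `z` in the half-plane of absolute convergence). -/
def zetaBarnesSeries (𝓜 : ℕ → Submodule K M) (i : ℕ) (z : ℂ) (w : ℝ) : ℂ :=
  ∑' n : ℕ, zetaBarnesTerm 𝓜 i z w n

/-- `Z` is the function `ζⁱ_M` of a graded module of dimension `m`: it is meromorphic on `ℂ`, and
`Z(z) = lim_{w ↘ 0} (ζⁱ_M(z, w) - H(M, 0) w ^ (-z))` on the half-plane `Re z > m + i`, where the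
series converge. By the identity theorem two such functions agree off a set without limit points
in `ℂ`, so they have the same residues. -/
structure IsHigherZeta (𝓜 : ℕ → Submodule K M) (m i : ℕ) (Z : ℂ → ℂ) : Prop where
  meromorphic : MeromorphicOn Z Set.univ
  tendsto : ∀ z : ℂ, (m : ℝ) + (i : ℝ) < z.re →
    Filter.Tendsto
      (fun w : ℝ => zetaBarnesSeries 𝓜 i z w - (hilbertFunction 𝓜 0 : ℂ) * (w : ℂ) ^ (-z))
      (nhdsWithin 0 (Set.Ioi 0)) (nhds (Z z))

open Classical in
/-- The meromorphic function `ζⁱ_M` on `ℂ` attached to the `i`-th iterated Hilbert function of a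
graded module of dimension `m`. -/
def higherZeta (𝓜 : ℕ → Submodule K M) (m i : ℕ) : ℂ → ℂ :=
  if h : ∃ Z : ℂ → ℂ, IsHigherZeta 𝓜 m i Z then h.choose else 0

end HilbertFunction

/-- The residue at `a` of a function `f` that is meromorphic at `a`: the common value of
`(2πi)⁻¹ ∮ f(z) dz` over all sufficiently small circles around `a`, written as a limit. -/
def residue (f : ℂ → ℂ) (a : ℂ) : ℂ :=
  Filter.limUnder (nhdsWithin (0 : ℝ) (Set.Ioi 0)) fun r : ℝ =>
    (2 * (Real.pi : ℂ) * Complex.I)⁻¹ * ∮ z in C(a, r), f z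

/-- `Rⁱ_M(a)`: the residue of `ζⁱ_M` at `a`, for a graded module of dimension `m`. -/
def higherZetaResidue {K M : Type*} [Field K] [AddCommGroup M] [Module K M]
    (𝓜 : ℕ → Submodule K M) (m i : ℕ) (a : ℂ) : ℂ :=
  residue (higherZeta 𝓜 m i) a

end GradedZeta

end

noncomputable section

namespace GradedZeta

/-! Dividing the Hilbert series by `1 - t` turns its coefficients into partial sums, so the iterated
Hilbert function has generating function `h(t) / (1 - t) ^ (m + 1)`. For large `n` it is therefore a
polynomial `P(n)` of degree at most `m` whose coefficient in degree `m` is `h(1) / m!`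
(`coeff_hilbertPoly_succ`). Up to finitely many terms, its Dirichlet series is `∑ k ≤ m, P_k ζ(z -
k)`. This gives the continuation (`polyZeta`); near `m + 1` only `k = m` has a pole, with residue
`P_m`.

The algebraic content is that the pole of the Hilbert series at `1` has order at most `m`.
Hilbert–Serre gives rationality with some pole order `N`. Noether normalization of `S / Ann M` gives
the growth bound `O(n ^ m)` for the iterated Hilbert function (`exists_finiteDimensional_and_le`). A
pole of order greater than `m` would force faster growth, so numerator and denominator share factors
`1 - t` until the exponent is `m` (`exists_isHilbertNumerator_of_le`). The normalization need not be
graded, since only growth is extracted from it. -/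

/-! ### Krull dimension and Noether normalization. -/

/-- An integral extension has Krull dimension at least that of the base. -/
theorem ringKrullDim_le_of_isIntegral {R A : Type*} [CommRing R] [CommRing A] [Algebra R A]
    [Algebra.IsIntegral R A] (hinj : Function.Injective (algebraMap R A)) :
    ringKrullDim R ≤ ringKrullDim A := by
  have hker : RingHom.ker (algebraMap R A) = ⊥ := (RingHom.injective_iff_ker_eq_bot _).1 hinj
  -- Incomparability makes contraction strictly monotone, and going up lifts every chain that starts
  -- at the contraction of `Q`.
  have hcoheight : ∀ Q : PrimeSpectrum A,
      Order.coheight Q = Order.coheight (PrimeSpectrum.comap (algebraMap R A) Q) := by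
    refine Order.coheight_eq_of_strictMono _ ?_ ?_
    · intro Q Q' h
      exact Ideal.IsIntegral.comap_lt_comap (R := R) h
    · intro Q P h
      obtain ⟨Q', hle, hprime, hcomap⟩ :=
        Ideal.exists_ideal_over_prime_of_isIntegral_of_isPrime P.asIdeal Q.asIdeal h.le
      refine ⟨⟨Q', hprime⟩, lt_of_le_of_ne hle ?_, PrimeSpectrum.ext hcomap⟩
      rintro rfl
      exact h.ne (PrimeSpectrum.ext hcomap)
  rw [ringKrullDim, Order.krullDim_eq_iSup_coheight]
  refine iSup_le fun P => ?_
  obtain ⟨Q, -, hprime, hcomap⟩ := Ideal.exists_ideal_over_prime_of_isIntegral (S := A)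
    P.asIdeal ⊥ (by rw [← RingHom.ker_eq_comap_bot, hker]; exact bot_le)
  have hP : PrimeSpectrum.comap (algebraMap R A) ⟨Q, hprime⟩ = P := PrimeSpectrum.ext hcomap
  rw [← hP, ← hcoheight]
  exact Order.coheight_le_krullDim _

/-- Noether normalization for a module: a finite module of dimension at most `m` over a finitely
generated algebra is finite over a polynomial ring in at most `m` variables. -/
theorem exists_noetherNormalization_module {K S M : Type*} [Field K] [CommRing S] [Algebra K S]
    [Algebra.FiniteType K S] [AddCommGroup M] [Module S M] [Module.Finite S M] [Nontrivial M]
    {m : ℕ} (hm : Module.supportDim S M ≤ (m : WithBot ℕ∞)) :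
    ∃ s ≤ m, ∃ (g : MvPolynomial (Fin s) K →ₐ[K] S) (r : ℕ) (v : Fin r → M),
      ∀ x : M, ∃ c : Fin r → MvPolynomial (Fin s) K, x = ∑ j, g (c j) • v j := by
  set I := Module.annihilator S M with hI
  have : Nontrivial (S ⧸ I) := by
    refine Ideal.Quotient.nontrivial_iff.2 fun h => ?_
    obtain ⟨x, hx⟩ := exists_ne (0 : M)
    have h1 : (1 : S) ∈ I := h ▸ Submodule.mem_top
    exact hx (by simpa using Module.mem_annihilator.1 h1 x)
  obtain ⟨s, φ, hinj, hfin⟩ := exists_finite_inj_algHom_of_fg K (S ⧸ I)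
  refine ⟨s, ?_, ?_⟩
  · rw [Module.supportDim_eq_ringKrullDim_quotient_annihilator] at hm
    let := φ.toRingHom.toAlgebra
    have : Algebra.IsIntegral (MvPolynomial (Fin s) K) (S ⧸ I) := ⟨hfin.to_isIntegral⟩
    have := (ringKrullDim_le_of_isIntegral (R := MvPolynomial (Fin s) K) (A := S ⧸ I) hinj).trans hm
    rw [MvPolynomial.ringKrullDim_of_isNoetherianRing, ringKrullDim_eq_zero_of_field] at this
    simpa using this
  -- Lift `φ` to `S` on the variables. Since `I` kills `M`, `g p` and `φ p` act on `M` alike, and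
  -- finiteness passes along polynomial ring, `S ⧸ I`, `M`.
  · set g : MvPolynomial (Fin s) K →ₐ[K] S :=
      MvPolynomial.aeval fun i => Function.surjInv Ideal.Quotient.mk_surjective (φ (MvPolynomial.X i))
    have hg : (Ideal.Quotient.mkₐ K I).comp g = φ := by
      refine MvPolynomial.algHom_ext fun i => ?_
      simp only [g, AlgHom.comp_apply, MvPolynomial.aeval_X, Ideal.Quotient.mkₐ_eq_mk]
      exact Function.surjInv_eq _ _
    let : Module (MvPolynomial (Fin s) K) (S ⧸ I) := φ.toRingHom.toModule
    let : Module (MvPolynomial (Fin s) K) M := Module.compHom M g.toRingHom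
    have hφ : ∀ p, φ p = Ideal.Quotient.mk I (g p) := fun p => (DFunLike.congr_fun hg p).symm
    have : Module.Finite (MvPolynomial (Fin s) K) (S ⧸ I) := hfin
    have htor := Module.isTorsionBySet_annihilator S M
    let : Module (S ⧸ I) M := htor.module
    have : IsScalarTower S (S ⧸ I) M := htor.isScalarTower
    have : Module.Finite (S ⧸ I) M := Module.Finite.of_restrictScalars_finite S (S ⧸ I) M
    have : IsScalarTower (MvPolynomial (Fin s) K) (S ⧸ I) M := by
      refine ⟨fun p a x => ?_⟩
      obtain ⟨b, rfl⟩ := Ideal.Quotient.mk_surjective a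
      change (φ p * Ideal.Quotient.mk I b) • x = g p • (b • x)
      rw [hφ, ← map_mul, ← mul_smul]
      rfl
    have : Module.Finite (MvPolynomial (Fin s) K) M := Module.Finite.trans (S ⧸ I) M
    obtain ⟨r, v, hv⟩ := Module.Finite.exists_fin (R := MvPolynomial (Fin s) K) (M := M)
    refine ⟨g, r, v, fun x => ?_⟩
    have hx : x ∈ Submodule.span (MvPolynomial (Fin s) K) (Set.range v) := hv ▸ Submodule.mem_top
    obtain ⟨c, hc⟩ := (Submodule.mem_span_range_iff_exists_fun _).1 hx
    exact ⟨c, hc.symm⟩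

/-! ### Homogeneous components and degree-one generators. -/

section Components

variable {K M : Type*} [Field K] [AddCommGroup M] [Module K M]

/-- The projection of a graded vector space onto its component of degree `n`. -/
def component (𝓜 : ℕ → Submodule K M) [DirectSum.Decomposition 𝓜] (n : ℕ) : M →ₗ[K] M :=
  (𝓜 n).subtype ∘ₗ DirectSum.component K ℕ (fun i => 𝓜 i) n ∘ₗ
    (DirectSum.decomposeLinearEquiv 𝓜).toLinearMap

variable (𝓜 : ℕ → Submodule K M) [DirectSum.Decomposition 𝓜]

theorem component_mem (n : ℕ) (x : M) : component 𝓜 n x ∈ 𝓜 n :=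
  (DirectSum.decompose 𝓜 x n).2

theorem component_of_mem {n : ℕ} {x : M} (hx : x ∈ 𝓜 n) : component 𝓜 n x = x :=
  DirectSum.decompose_of_mem_same 𝓜 hx

theorem component_of_mem_ne {n k : ℕ} {x : M} (hx : x ∈ 𝓜 n) (h : n ≠ k) :
    component 𝓜 k x = 0 :=
  DirectSum.decompose_of_mem_ne 𝓜 hx h

theorem exists_component_eq_zero (x : M) : ∃ N, ∀ n ≥ N, component 𝓜 n x = 0 := by
  induction x using DirectSum.Decomposition.inductionOn 𝓜 with
  | zero => exact ⟨0, fun n _ => map_zero _⟩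
  | @homogeneous i x => exact ⟨i + 1, fun n hn => component_of_mem_ne 𝓜 x.2 (by omega)⟩
  | add x y hx hy =>
    obtain ⟨N, hN⟩ := hx
    obtain ⟨N', hN'⟩ := hy
    exact ⟨max N N', fun n hn => by
      rw [map_add, hN n (le_of_max_le_left hn), hN' n (le_of_max_le_right hn), add_zero]⟩

theorem sum_mem_injective {n : ℕ} :
    Function.Injective fun f : (j : Fin n) → 𝓜 j => ∑ j, (f j : M) := by
  intro f f' h
  have key : ∀ (f : (j : Fin n) → 𝓜 j) (k : Fin n), component 𝓜 k (∑ j, (f j : M)) = f k := by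
    intro f k
    rw [map_sum, Finset.sum_eq_single k]
    · exact component_of_mem 𝓜 (f k).2
    · exact fun j _ hj => component_of_mem_ne 𝓜 (f j).2 fun e => hj (Fin.ext e)
    · simp
  funext k
  apply Subtype.ext
  rw [← key f k, ← key f' k]
  exact congrArg _ h

/-- If the pieces of degree at most `n` all lie in `W`, then their dimensions add up to at most
`dim W`. -/
theorem sum_finrank_le_finrank {n : ℕ} {W : Submodule K M} [FiniteDimensional K W]
    (hW : ∀ j < n, 𝓜 j ≤ W) :
    ∑ j ∈ Finset.range n, Module.finrank K (𝓜 j) ≤ Module.finrank K W := by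
  have hfin : ∀ j : Fin n, FiniteDimensional K (𝓜 j) :=
    fun j => Submodule.finiteDimensional_of_le (hW j j.2)
  have := LinearMap.finrank_le_finrank_of_injective
    (f := (∑ j : Fin n, (Submodule.inclusion (hW j j.2)) ∘ₗ LinearMap.proj j :
      ((j : Fin n) → 𝓜 j) →ₗ[K] W)) (by
      intro f f' h
      apply sum_mem_injective 𝓜
      simpa using congrArg (Subtype.val) h)
  rwa [Module.finrank_pi_fintype, Fin.sum_univ_eq_sum_range fun j => Module.finrank K (𝓜 j)] at this

variable {S : Type*} [CommRing S] [Algebra K S] {𝒮 : ℕ → Submodule K S}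
  [Module S M] [SetLike.GradedSMul 𝒮 𝓜]

theorem component_succ_smul {t : S} (ht : t ∈ 𝒮 1) (n : ℕ) (x : M) :
    component 𝓜 (n + 1) (t • x) = t • component 𝓜 n x := by
  induction x using DirectSum.Decomposition.inductionOn 𝓜 with
  | zero => simp
  | @homogeneous i x =>
    have hx : t • (x : M) ∈ 𝓜 (i + 1) := by
      simpa [add_comm] using SetLike.GradedSMul.smul_mem ht x.2
    by_cases h : i = n
    · subst h
      rw [component_of_mem 𝓜 hx, component_of_mem 𝓜 x.2]
    · rw [component_of_mem_ne 𝓜 hx (by omega), component_of_mem_ne 𝓜 x.2 h, smul_zero]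
  | add x y hx hy => rw [smul_add, map_add, hx, hy, map_add, smul_add]

theorem component_zero_smul {t : S} (ht : t ∈ 𝒮 1) (x : M) :
    component 𝓜 0 (t • x) = 0 := by
  induction x using DirectSum.Decomposition.inductionOn 𝓜 with
  | zero => simp
  | @homogeneous i x =>
    have hx : t • (x : M) ∈ 𝓜 (i + 1) := by
      simpa [add_comm] using SetLike.GradedSMul.smul_mem ht x.2
    exact component_of_mem_ne 𝓜 hx (by omega)
  | add x y hx hy => rw [smul_add, map_add, hx, hy, add_zero]

end Components

/-- A `K`-subspace of `M` stable under algebra generators of `S` is stable under `S`. -/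
theorem smul_mem_of_adjoin_eq_top {K S M : Type*} [Field K] [CommRing S] [Algebra K S]
    [AddCommGroup M] [Module K M] [Module S M] [IsScalarTower K S M] {T : Set S}
    (hT : Algebra.adjoin K T = ⊤) (N : Submodule K M) (hN : ∀ t ∈ T, ∀ x ∈ N, t • x ∈ N)
    (a : S) {x : M} (hx : x ∈ N) : a • x ∈ N := by
  have ha : a ∈ Algebra.adjoin K T := hT ▸ Algebra.mem_top
  induction ha using Algebra.adjoin_induction generalizing x with
  | mem t ht => exact hN t ht x hx
  | algebraMap c => rw [algebraMap_smul]; exact N.smul_mem c hx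
  | add a b _ _ iha ihb => rw [add_smul]; exact N.add_mem (iha hx) (ihb hx)
  | mul a b _ _ iha ihb => rw [mul_smul]; exact iha (ihb hx)

/-- A standard graded algebra is generated by finitely many elements of degree one. -/
theorem IsStandardGraded.exists_finset {K S : Type*} [Field K] [CommRing S] [Algebra K S]
    {𝒮 : ℕ → Submodule K S} (h : IsStandardGraded 𝒮) :
    ∃ T : Finset S, (∀ t ∈ T, t ∈ 𝒮 1) ∧ Algebra.adjoin K (T : Set S) = ⊤ := by
  classical
  obtain ⟨G, hG⟩ := h.finiteType.out
  -- Each element of the finite generating set `G` involves only finitely many elements of degree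
  -- one.
  have key : ∀ a : S, ∃ T : Finset S, (T : Set S) ⊆ 𝒮 1 ∧ a ∈ Algebra.adjoin K (T : Set S) := by
    intro a
    have ha : a ∈ Algebra.adjoin K (𝒮 1 : Set S) := h.adjoin_one ▸ Algebra.mem_top
    induction ha using Algebra.adjoin_induction with
    | mem t ht => exact ⟨{t}, by simpa using ht, Algebra.subset_adjoin (by simp)⟩
    | algebraMap c => exact ⟨∅, by simp, Subalgebra.algebraMap_mem _ c⟩
    | add a b _ _ iha ihb =>
      obtain ⟨T, hT, ha⟩ := iha
      obtain ⟨T', hT', hb⟩ := ihb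
      refine ⟨T ∪ T', by simp [hT, hT'], Subalgebra.add_mem _
        (Algebra.adjoin_mono (by simp) ha) (Algebra.adjoin_mono (by simp) hb)⟩
    | mul a b _ _ iha ihb =>
      obtain ⟨T, hT, ha⟩ := iha
      obtain ⟨T', hT', hb⟩ := ihb
      refine ⟨T ∪ T', by simp [hT, hT'], Subalgebra.mul_mem _
        (Algebra.adjoin_mono (by simp) ha) (Algebra.adjoin_mono (by simp) hb)⟩
  choose T hT ha using key
  refine ⟨G.biUnion T, ?_, ?_⟩
  · intro t ht
    obtain ⟨a, -, hta⟩ := Finset.mem_biUnion.1 ht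
    exact hT a hta
  · rw [eq_top_iff, ← hG, Algebra.adjoin_le_iff]
    intro a haG
    refine Algebra.adjoin_mono ?_ (ha a)
    exact_mod_cast Finset.subset_biUnion_of_mem T haG

/-! ### Polynomial growth of the iterated Hilbert function. -/

section Growth

variable {K S M : Type*} [Field K] [CommRing S] [Algebra K S]
  [AddCommGroup M] [Module K M] [Module S M]
  {s r : ℕ} (g : MvPolynomial (Fin s) K →ₐ[K] S) (v : Fin r → M)

/-- The span of the `X ^ a • v j`, where all exponents in `a` are at most `n`. -/
def boxSpan (n : ℕ) : Submodule K M :=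
  Submodule.span K {x | ∃ (a : Fin s →₀ ℕ) (j : Fin r), (∀ i, a i ≤ n) ∧
    x = g (MvPolynomial.monomial a 1) • v j}

theorem boxSpan_mono : Monotone (boxSpan g v) := fun _ _ h =>
  Submodule.span_mono fun _ ⟨a, j, ha, hx⟩ => ⟨a, j, fun i => (ha i).trans h, hx⟩

theorem boxSpan_eq_span_range (n : ℕ) :
    boxSpan g v n = Submodule.span K (Set.range fun p : (Fin s → Fin (n + 1)) × Fin r =>
      g (MvPolynomial.monomial (Finsupp.equivFunOnFinite.symm fun i => (p.1 i : ℕ)) 1) • v p.2) := by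
  refine congrArg _ (Set.ext fun x => ⟨?_, ?_⟩)
  · rintro ⟨a, j, ha, rfl⟩
    have h : (Finsupp.equivFunOnFinite.symm fun i => a i) = a := Finsupp.ext fun _ => rfl
    exact ⟨⟨fun i => ⟨a i, Nat.lt_succ_of_le (ha i)⟩, j⟩,
      congrArg (fun b => g (MvPolynomial.monomial b 1) • v j) h⟩
  · rintro ⟨p, rfl⟩
    exact ⟨_, p.2, fun i => by simpa using Nat.le_of_lt_succ (p.1 i).2, rfl⟩

instance finiteDimensional_boxSpan (n : ℕ) : FiniteDimensional K (boxSpan g v n) := by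
  rw [boxSpan_eq_span_range]
  exact FiniteDimensional.span_of_finite K (Set.finite_range _)

theorem finrank_boxSpan_le (n : ℕ) : Module.finrank K (boxSpan g v n) ≤ (n + 1) ^ s * r := by
  rw [boxSpan_eq_span_range]
  refine (finrank_range_le_card _).trans ?_
  simp

theorem exists_mem_boxSpan [IsScalarTower K S M]
    (hv : ∀ x : M, ∃ c : Fin r → MvPolynomial (Fin s) K, x = ∑ j, g (c j) • v j) (x : M) :
    ∀ᶠ n in Filter.atTop, x ∈ boxSpan g v n := by
  suffices h : ∃ n, x ∈ boxSpan g v n by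
    obtain ⟨n, hn⟩ := h
    exact Filter.eventually_atTop.2 ⟨n, fun k hk => boxSpan_mono g v hk hn⟩
  obtain ⟨c, rfl⟩ := hv x
  -- One bound that dominates every exponent in every coefficient `c j`.
  refine ⟨∑ j, (c j).totalDegree, Submodule.sum_mem _ fun j _ => ?_⟩
  rw [(c j).as_sum, map_sum, Finset.sum_smul]
  refine Submodule.sum_mem _ fun a ha => ?_
  have hmon : MvPolynomial.monomial a ((c j).coeff a)
      = (c j).coeff a • MvPolynomial.monomial a (1 : K) := by
    rw [MvPolynomial.smul_monomial, smul_eq_mul, mul_one]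
  rw [hmon, map_smul, smul_assoc]
  refine Submodule.smul_mem _ _ (Submodule.subset_span ⟨a, j, fun i => ?_, rfl⟩)
  calc a i ≤ a.sum fun _ e => e := by
        by_cases h : i ∈ a.support
        · exact Finset.single_le_sum (f := fun i => a i) (fun _ _ => Nat.zero_le _) h
        · simp [Finsupp.notMem_support_iff.1 h]
    _ ≤ (c j).totalDegree := MvPolynomial.le_totalDegree ha
    _ ≤ ∑ j, (c j).totalDegree :=
        Finset.single_le_sum (f := fun j => (c j).totalDegree) (fun _ _ => Nat.zero_le _)
          (Finset.mem_univ j)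

/-- `t` commutes past the monomial onto `v j`, and exponents add under multiplication of monomials.
-/
theorem smul_mem_boxSpan [IsScalarTower K S M] {t : S} {D : ℕ} (ht : ∀ j, t • v j ∈ boxSpan g v D) {n : ℕ} {x : M}
    (hx : x ∈ boxSpan g v n) : t • x ∈ boxSpan g v (n + D) := by
  induction hx using Submodule.span_induction with
  | mem x hx =>
    obtain ⟨a, j, ha, rfl⟩ := hx
    rw [smul_comm]
    have hy := ht j
    generalize t • v j = y at hy
    induction hy using Submodule.span_induction with
    | mem y hy =>
      obtain ⟨b, k, hb, rfl⟩ := hy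
      rw [← mul_smul, ← map_mul, MvPolynomial.monomial_mul, one_mul]
      exact Submodule.subset_span ⟨_, k, fun i => Nat.add_le_add (ha i) (hb i), rfl⟩
    | zero => rw [smul_zero]; exact Submodule.zero_mem _
    | add y z _ _ hy hz => rw [smul_add]; exact Submodule.add_mem _ hy hz
    | smul c y _ hy => rw [smul_comm]; exact Submodule.smul_mem _ _ hy
  | zero => rw [smul_zero]; exact Submodule.zero_mem _
  | add y z _ _ hy hz => rw [smul_add]; exact Submodule.add_mem _ hy hz
  | smul c y _ hy => rw [smul_comm]; exact Submodule.smul_mem _ _ hy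

end Growth

section GradedGrowth

variable {K S M : Type*} [Field K] [CommRing S] [Algebra K S]
  {𝒮 : ℕ → Submodule K S} [AddCommGroup M] [Module K M] [Module S M] [IsScalarTower K S M]
  (𝓜 : ℕ → Submodule K M) [DirectSum.Decomposition 𝓜] [SetLike.GradedSMul 𝒮 𝓜]

/-- Boxes grow linearly with the degree: each degree-one generator enlarges the box by at most a
fixed `D`. As the `v j` need not be homogeneous, the argument follows their components. -/
theorem exists_le_boxSpan (h𝒮 : IsStandardGraded 𝒮)
    {s r : ℕ} (g : MvPolynomial (Fin s) K →ₐ[K] S) (v : Fin r → M)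
    (hv : ∀ x : M, ∃ c : Fin r → MvPolynomial (Fin s) K, x = ∑ j, g (c j) • v j) :
    ∃ D, ∀ n, 𝓜 n ≤ boxSpan g v ((n + 1) * D) := by
  obtain ⟨T, hT1, hT⟩ := h𝒮.exists_finset
  have hev := exists_mem_boxSpan g v hv
  have h1 : ∀ᶠ D in Filter.atTop, ∀ t ∈ T, ∀ j, t • v j ∈ boxSpan g v D :=
    (Filter.eventually_all_finset T).2 fun t _ => Filter.eventually_all.2 fun j => hev _
  have h2 : ∀ᶠ D in Filter.atTop, ∀ j n, component 𝓜 n (v j) ∈ boxSpan g v D := by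
    refine Filter.eventually_all.2 fun j => ?_
    obtain ⟨N, hN⟩ := exists_component_eq_zero 𝓜 (v j)
    have : ∀ᶠ D in Filter.atTop, ∀ n ∈ Finset.range N, component 𝓜 n (v j) ∈ boxSpan g v D :=
      (Filter.eventually_all_finset _).2 fun n _ => hev _
    filter_upwards [this] with D hD n
    by_cases h : n < N
    · exact hD n (Finset.mem_range.2 h)
    · rw [hN n (not_lt.1 h)]
      exact Submodule.zero_mem _
  obtain ⟨D, hD1, hD2⟩ := (h1.and h2).exists
  refine ⟨D, fun n x hx => ?_⟩
  -- The elements satisfying the bound in all degrees at once form a subspace stable under the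
  -- generators, hence under `S`. It contains every `v j`, so it is all of `M`.
  let N : Submodule K M := ⨅ n, (boxSpan g v ((n + 1) * D)).comap (component 𝓜 n)
  have hN : ∀ x, x ∈ N ↔ ∀ n, component 𝓜 n x ∈ boxSpan g v ((n + 1) * D) := fun x => by
    simp [N, Submodule.mem_iInf]
  suffices hx' : x ∈ N by
    have := (hN x).1 hx' n
    rwa [component_of_mem 𝓜 hx] at this
  obtain ⟨c, rfl⟩ := hv x
  refine Submodule.sum_mem _ fun j _ => smul_mem_of_adjoin_eq_top hT N ?_ _ ?_
  · intro t ht x hx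
    rw [hN] at hx ⊢
    rintro (_ | n)
    · rw [component_zero_smul 𝓜 (hT1 t ht)]
      exact Submodule.zero_mem _
    · rw [component_succ_smul 𝓜 (hT1 t ht), add_mul (n + 1) 1 D, one_mul]
      exact smul_mem_boxSpan g v (hD1 t ht) (hx n)
  · rw [hN]
    exact fun n => boxSpan_mono g v (Nat.le_mul_of_pos_left D n.succ_pos) (hD2 j n)

/-- The iterated Hilbert function of a module of dimension at most `m` is `O(n ^ m)`. -/
theorem exists_finiteDimensional_and_le (h𝒮 : IsStandardGraded 𝒮)
    [Module.Finite S M] [Nontrivial M] {m : ℕ}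
    (hm : Module.supportDim S M ≤ (m : WithBot ℕ∞)) :
    (∀ n, FiniteDimensional K (𝓜 n)) ∧
      ∃ C, ∀ n, iteratedHilbertFunction 𝓜 1 n ≤ C * (n + 1) ^ m := by
  have := h𝒮.finiteType
  obtain ⟨s, hs, g, r, v, hv⟩ := exists_noetherNormalization_module (K := K) hm
  obtain ⟨D, hD⟩ := exists_le_boxSpan 𝓜 h𝒮 g v hv
  refine ⟨fun n => Submodule.finiteDimensional_of_le (hD n), (D + 1) ^ s * r, fun n => ?_⟩
  calc iteratedHilbertFunction 𝓜 1 n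
      ≤ Module.finrank K (boxSpan g v ((n + 1) * D)) :=
        sum_finrank_le_finrank 𝓜 fun j hj =>
          (hD j).trans (boxSpan_mono g v (Nat.mul_le_mul_right D hj))
    _ ≤ ((n + 1) * D + 1) ^ s * r := finrank_boxSpan_le g v _
    _ ≤ ((n + 1) * (D + 1)) ^ s * r := by gcongr; nlinarith
    _ = (D + 1) ^ s * r * (n + 1) ^ s := by rw [mul_pow]; ring
    _ ≤ (D + 1) ^ s * r * (n + 1) ^ m := by gcongr; omega

end GradedGrowth

/-! ### The Hilbert–Serre theorem, for subquotients `B / A` of the fixed graded module `M`. -/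

section HilbertSerre

variable {K S M : Type*} [Field K] [CommRing S] [Algebra K S]
  {𝒮 : ℕ → Submodule K S} [AddCommGroup M] [Module K M] [Module S M]
  (𝓜 : ℕ → Submodule K M)

theorem finrank_map_add_finrank_inf_ker (f : M →ₗ[K] M) (V : Submodule K M)
    [FiniteDimensional K V] :
    Module.finrank K (V.map f) + Module.finrank K (V ⊓ LinearMap.ker f : Submodule K M)
      = Module.finrank K V := by
  have h := LinearMap.finrank_range_add_finrank_ker (f.domRestrict V)
  rw [LinearMap.range_domRestrict, LinearMap.ker_domRestrict] at h
  rw [← h, ← Submodule.finrank_map_subtype_eq V, Submodule.map_comap_subtype]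

variable [IsScalarTower K S M]

/-- The Hilbert function of a homogeneous submodule. -/
def subHilbert (A : Submodule S M) (n : ℕ) : ℤ :=
  Module.finrank K (A.restrictScalars K ⊓ 𝓜 n : Submodule K M)

/-- The Hilbert series of a homogeneous submodule. -/
def subHilbertSeries (A : Submodule S M) : PowerSeries ℤ :=
  PowerSeries.mk (subHilbert 𝓜 A)

theorem subHilbert_eq_finrank {A : Submodule S M} {n : ℕ} {V : Submodule K M}
    (h : A.restrictScalars K ⊓ 𝓜 n = V) : subHilbert 𝓜 A n = Module.finrank K V := by
  rw [subHilbert, h]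

variable [DirectSum.Decomposition 𝓜]

/-- A submodule containing the homogeneous components of its elements. -/
def IsComponentClosed (A : Submodule S M) : Prop :=
  ∀ x ∈ A, ∀ n, component 𝓜 n x ∈ A

variable {𝓜} {A B : Submodule S M}

/-- Finitely many elements generate `B`, and their components vanish in high degree. Every further
multiplication by a generator lands in `A`, which contributes nothing modulo `A`. -/
theorem exists_forall_component_mem {T : Finset S} (hT : Algebra.adjoin K (T : Set S) = ⊤)
    [IsNoetherian S M] (hA : IsComponentClosed 𝓜 A) (hAB : ∀ t ∈ T, ∀ b ∈ B, t • b ∈ A) :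
    ∃ N, ∀ n ≥ N, ∀ x ∈ B, component 𝓜 n x ∈ A := by
  obtain ⟨W, hW⟩ := (isNoetherian_def.1 ‹IsNoetherian S M›) B
  choose N hN using exists_component_eq_zero 𝓜
  refine ⟨W.sup N, fun n hn x hx => ?_⟩
  let V : Submodule K M := B.restrictScalars K ⊓ (A.restrictScalars K).comap (component 𝓜 n)
  suffices hx' : x ∈ V from hx'.2
  rw [← hW] at hx
  induction hx using Submodule.span_induction with
  | mem x hx =>
    refine ⟨hW ▸ Submodule.subset_span hx, ?_⟩
    have : component 𝓜 n x = 0 := hN x n ((Finset.le_sup (f := N) hx).trans hn)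
    simp [this]
  | zero => exact V.zero_mem
  | add x y _ _ hx hy => exact V.add_mem hx hy
  | smul a x _ hx =>
    refine smul_mem_of_adjoin_eq_top hT V ?_ a hx
    exact fun t ht y hy => ⟨B.smul_mem t hy.1, hA _ (hAB t ht y hy.1) n⟩

theorem exists_polynomial_of_smul_mem {T : Finset S} (hT : Algebra.adjoin K (T : Set S) = ⊤)
    [IsNoetherian S M] (hA : IsComponentClosed 𝓜 A) (hle : A ≤ B)
    (hAB : ∀ t ∈ T, ∀ b ∈ B, t • b ∈ A) :
    ∃ p : Polynomial ℤ, (p : PowerSeries ℤ) = subHilbertSeries 𝓜 B - subHilbertSeries 𝓜 A := by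
  obtain ⟨N, hN⟩ := exists_forall_component_mem hT hA hAB
  refine ⟨PowerSeries.trunc N (subHilbertSeries 𝓜 B - subHilbertSeries 𝓜 A), ?_⟩
  ext n
  rw [Polynomial.coeff_coe, PowerSeries.coeff_trunc]
  split_ifs with h
  · rfl
  · have : B.restrictScalars K ⊓ 𝓜 n = A.restrictScalars K ⊓ 𝓜 n := by
      refine le_antisymm (fun x hx => ⟨?_, hx.2⟩) (inf_le_inf_right _ hle)
      have := hN n (not_lt.1 h) x hx.1
      rwa [component_of_mem 𝓜 hx.2] at this
    have h' : subHilbert 𝓜 B n = subHilbert 𝓜 A n := subHilbert_eq_finrank 𝓜 this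
    simp [subHilbertSeries, h']

section Step

variable [SetLike.GradedSMul 𝒮 𝓜] {t : S}

omit [IsScalarTower K S M] in
theorem IsComponentClosed.sup_smul (ht : t ∈ 𝒮 1) (hA : IsComponentClosed 𝓜 A)
    (hB : IsComponentClosed 𝓜 B) :
    IsComponentClosed 𝓜 (A ⊔ B.map (LinearMap.lsmul S M t)) := by
  intro x hx n
  obtain ⟨a, ha, y, ⟨b, hb, rfl⟩, rfl⟩ := Submodule.mem_sup.1 hx
  rw [map_add]
  refine Submodule.add_mem _ (Submodule.mem_sup_left (hA a ha n)) ?_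
  rw [LinearMap.lsmul_apply]
  cases n with
  | zero => rw [component_zero_smul 𝓜 ht]; exact Submodule.zero_mem _
  | succ n =>
    rw [component_succ_smul 𝓜 ht]
    exact Submodule.mem_sup_right ⟨_, hB b hb n, rfl⟩

omit [IsScalarTower K S M] in
theorem IsComponentClosed.inf_comap_smul (ht : t ∈ 𝒮 1) (hA : IsComponentClosed 𝓜 A)
    (hB : IsComponentClosed 𝓜 B) :
    IsComponentClosed 𝓜 (B ⊓ A.comap (LinearMap.lsmul S M t)) := by
  refine fun x hx n => ⟨hB x hx.1 n, ?_⟩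
  have := hA _ hx.2 (n + 1)
  rwa [LinearMap.lsmul_apply, component_succ_smul 𝓜 ht] at this

/-- Multiplication by `t` maps `Bₙ` onto the quotient of `(A + tB)ₙ₊₁` by `Aₙ₊₁`, with kernel
`(A : t) ∩ Bₙ`. -/
theorem subHilbert_succ [∀ n, FiniteDimensional K (𝓜 n)] (ht : t ∈ 𝒮 1)
    (hA : IsComponentClosed 𝓜 A) (hB : IsComponentClosed 𝓜 B) (n : ℕ) :
    subHilbert 𝓜 (A ⊔ B.map (LinearMap.lsmul S M t)) (n + 1) - subHilbert 𝓜 A (n + 1)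
      = subHilbert 𝓜 B n - subHilbert 𝓜 (B ⊓ A.comap (LinearMap.lsmul S M t)) n := by
  have hfin : ∀ (n : ℕ) (V : Submodule K M), FiniteDimensional K (V ⊓ 𝓜 n : Submodule K M) :=
    fun n V => Submodule.finiteDimensional_of_le inf_le_right
  let f : M →ₗ[K] M := (LinearMap.lsmul S M t).restrictScalars K
  have hf : ∀ x, f x = t • x := fun _ => rfl
  have htm : ∀ x ∈ 𝓜 n, t • x ∈ 𝓜 (n + 1) := fun x hx => by
    simpa [add_comm] using SetLike.GradedSMul.smul_mem ht hx
  set Bn := B.restrictScalars K ⊓ 𝓜 n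
  set Cn := (B ⊓ A.comap (LinearMap.lsmul S M t)).restrictScalars K ⊓ 𝓜 n
  set An := A.restrictScalars K ⊓ 𝓜 (n + 1)
  have : FiniteDimensional K (Bn.map f) := inferInstance
  -- Both restrictions of `f` have the same kernel, so `dim Bn - dim Cn = dim tBn - dim tCn`. Since
  -- `tCn = tBn ∩ An`, the sup/inf dimension formula finishes.
  have h1 := finrank_map_add_finrank_inf_ker f Bn
  have h2 := finrank_map_add_finrank_inf_ker f Cn
  have hker : Cn ⊓ LinearMap.ker f = Bn ⊓ LinearMap.ker f := by
    refine le_antisymm (fun x hx => ⟨⟨hx.1.1.1, hx.1.2⟩, hx.2⟩)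
      (fun x hx => ⟨⟨⟨hx.1.1, ?_⟩, hx.1.2⟩, hx.2⟩)
    have : t • x = 0 := hx.2
    change t • x ∈ A
    rw [this]
    exact A.zero_mem
  have hinf : Bn.map f ⊓ An = Cn.map f := by
    apply le_antisymm
    · rintro _ ⟨⟨x, hx, rfl⟩, hxA⟩
      exact ⟨x, ⟨⟨hx.1, hxA.1⟩, hx.2⟩, rfl⟩
    · rintro _ ⟨x, hx, rfl⟩
      exact ⟨⟨x, ⟨hx.1.1, hx.2⟩, rfl⟩, hx.1.2, htm x hx.2⟩
  have hsup : Bn.map f ⊔ An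
      = (A ⊔ B.map (LinearMap.lsmul S M t)).restrictScalars K ⊓ 𝓜 (n + 1) := by
    apply le_antisymm
    · refine sup_le ?_ (inf_le_inf_right _ ?_)
      · rintro _ ⟨x, hx, rfl⟩
        exact ⟨Submodule.mem_sup_right ⟨x, hx.1, rfl⟩, htm x hx.2⟩
      · exact fun x hx => Submodule.mem_sup_left hx
    · rintro x ⟨hx, hxn⟩
      obtain ⟨a, ha, _, ⟨b, hb, rfl⟩, rfl⟩ := Submodule.mem_sup.1 hx
      rw [← component_of_mem 𝓜 hxn, map_add, LinearMap.lsmul_apply, component_succ_smul 𝓜 ht]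
      exact Submodule.add_mem _
        (Submodule.mem_sup_right ⟨hA a ha _, component_mem 𝓜 _ _⟩)
        (Submodule.mem_sup_left ⟨_, ⟨hB b hb n, component_mem 𝓜 _ _⟩, rfl⟩)
  have h3 := Submodule.finrank_sup_add_finrank_inf_eq (Bn.map f) An
  rw [hinf, hsup] at h3
  rw [hker] at h2
  change (Module.finrank K _ : ℤ) - Module.finrank K An
    = Module.finrank K Bn - Module.finrank K Cn
  omega

theorem subHilbertSeries_mul_X [∀ n, FiniteDimensional K (𝓜 n)] (ht : t ∈ 𝒮 1)
    (hA : IsComponentClosed 𝓜 A) (hB : IsComponentClosed 𝓜 B) :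
    subHilbertSeries 𝓜 (A ⊔ B.map (LinearMap.lsmul S M t)) - subHilbertSeries 𝓜 A
      = (subHilbertSeries 𝓜 B
        - subHilbertSeries 𝓜 (B ⊓ A.comap (LinearMap.lsmul S M t))) * PowerSeries.X := by
  ext n
  cases n with
  | zero =>
    rw [PowerSeries.coeff_zero_mul_X]
    have : (A ⊔ B.map (LinearMap.lsmul S M t)).restrictScalars K ⊓ 𝓜 0
        = A.restrictScalars K ⊓ 𝓜 0 := by
      refine le_antisymm ?_ (inf_le_inf_right _ fun x hx => Submodule.mem_sup_left hx)
      rintro x ⟨hx, hx0⟩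
      refine ⟨?_, hx0⟩
      obtain ⟨a, ha, _, ⟨b, hb, rfl⟩, rfl⟩ := Submodule.mem_sup.1 hx
      rw [← component_of_mem 𝓜 hx0, map_add, LinearMap.lsmul_apply, component_zero_smul 𝓜 ht,
        add_zero]
      exact hA a ha 0
    have h' : subHilbert 𝓜 (A ⊔ B.map (LinearMap.lsmul S M t)) 0 = subHilbert 𝓜 A 0 :=
      subHilbert_eq_finrank 𝓜 this
    simp [subHilbertSeries, h']
  | succ n =>
    rw [PowerSeries.coeff_succ_mul_X]
    simpa [subHilbertSeries] using subHilbert_succ ht hA hB n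

end Step

/-- The Hilbert–Serre theorem for a subquotient of `M` on which all but the generators in `L` act
as zero. -/
theorem exists_polynomial_mul_one_sub_X_pow [SetLike.GradedSMul 𝒮 𝓜] [IsNoetherian S M]
    [∀ n, FiniteDimensional K (𝓜 n)] {T : Finset S} (hT : Algebra.adjoin K (T : Set S) = ⊤)
    (L : Finset S) (hL : ∀ t ∈ L, t ∈ 𝒮 1) (A B : Submodule S M)
    (hA : IsComponentClosed 𝓜 A) (hB : IsComponentClosed 𝓜 B) (hle : A ≤ B)
    (hAB : ∀ t ∈ T, t ∉ L → ∀ b ∈ B, t • b ∈ A) :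
    ∃ p : Polynomial ℤ, (p : PowerSeries ℤ)
      = (subHilbertSeries 𝓜 B - subHilbertSeries 𝓜 A) * (1 - PowerSeries.X) ^ L.card := by
  classical
  induction L using Finset.induction_on generalizing A B with
  | empty =>
    obtain ⟨p, hp⟩ := exists_polynomial_of_smul_mem hT hA hle fun t ht => hAB t ht (by simp)
    exact ⟨p, by simp [hp]⟩
  | insert t L htL ih =>
    have ht : t ∈ 𝒮 1 := hL t (Finset.mem_insert_self t L)
    have hL' : ∀ t ∈ L, t ∈ 𝒮 1 := fun u hu => hL u (Finset.mem_insert_of_mem hu)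
    have hstep := subHilbertSeries_mul_X ht hA hB
    set A' := B ⊓ A.comap (LinearMap.lsmul S M t)
    set B' := A ⊔ B.map (LinearMap.lsmul S M t)
    -- Kernel `A' / A` and cokernel `B / B'` of multiplication by `t` on `B / A` are both killed by
    -- `t`, so `t` can be dropped from `L`.
    obtain ⟨p, hp⟩ := ih hL' A A' hA (hA.inf_comap_smul ht hB)
      (fun x hx => ⟨hle hx, A.smul_mem t hx⟩) (fun u hu huL b hb => by
        by_cases hut : u = t
        · exact hut ▸ hb.2
        · exact hAB u hu (by simp [hut, huL]) b hb.1)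
    obtain ⟨q, hq⟩ := ih hL' B' B (hA.sup_smul ht hB) hB
      (sup_le hle (by rintro _ ⟨b, hb, rfl⟩; exact B.smul_mem t hb)) (fun u hu huL b hb => by
        by_cases hut : u = t
        · exact hut ▸ Submodule.mem_sup_right ⟨b, hb, rfl⟩
        · exact Submodule.mem_sup_left (hAB u hu (by simp [hut, huL]) b hb))
    -- `(1 - X)` times the series of `B / A` is the series of `B / B'` minus `X` times that of `A' /
    -- A`.
    refine ⟨q - Polynomial.X * p, ?_⟩
    rw [Finset.card_insert_of_notMem htL, pow_succ', Polynomial.coe_sub, Polynomial.coe_mul,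
      Polynomial.coe_X, hp, hq]
    linear_combination -(1 - PowerSeries.X) ^ L.card * hstep

/-- The Hilbert–Serre theorem. -/
theorem exists_isHilbertNumerator (h𝒮 : IsStandardGraded 𝒮) (𝓜 : ℕ → Submodule K M)
    [DirectSum.Decomposition 𝓜] [SetLike.GradedSMul 𝒮 𝓜] [Module.Finite S M]
    [∀ n, FiniteDimensional K (𝓜 n)] :
    ∃ N, ∃ p : Polynomial ℤ, IsHilbertNumerator 𝓜 N p := by
  obtain ⟨T, hT1, hT⟩ := h𝒮.exists_finset
  have := h𝒮.finiteType
  have : IsNoetherianRing S := Algebra.FiniteType.isNoetherianRing K S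
  have : IsNoetherian S M := isNoetherian_of_isNoetherianRing_of_finite S M
  obtain ⟨p, hp⟩ := exists_polynomial_mul_one_sub_X_pow (𝓜 := 𝓜) hT T hT1 ⊥ ⊤
    (fun x hx n => by rw [(Submodule.mem_bot S).1 hx, map_zero]; exact Submodule.zero_mem _)
    (fun _ _ _ => Submodule.mem_top) bot_le (fun t ht h => absurd ht h)
  refine ⟨T.card, p, hp.trans ?_⟩
  congr 1
  ext n
  have htop : (⊤ : Submodule S M).restrictScalars K ⊓ 𝓜 n = 𝓜 n := top_inf_eq _
  have hbot : (⊥ : Submodule S M).restrictScalars K ⊓ 𝓜 n = ⊥ := bot_inf_eq _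
  simp [subHilbertSeries, subHilbert_eq_finrank 𝓜 htop, subHilbert_eq_finrank 𝓜 hbot,
    hilbertSeries, hilbertFunction]

end HilbertSerre

/-! ### Hilbert polynomials and the pole order at `1`. -/

open Polynomial in
theorem natDegree_hilbertPoly_succ_le {F : Type*} [Field F] [CharZero F] (p : F[X]) (d : ℕ) :
    (hilbertPoly p (d + 1)).natDegree ≤ d := by
  rw [hilbertPoly_succ]
  refine natDegree_sum_le_of_forall_le _ _ fun i _ => ?_
  exact (natDegree_smul_le _ _).trans (natDegree_preHilbertPoly F d i).le

open Polynomial in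
-- Each `preHilbertPoly F d i` has coefficient `1 / d!` in degree `d`, independently of `i`, so the
-- coefficients of `p` simply add up.
theorem coeff_hilbertPoly_succ {F : Type*} [Field F] [CharZero F] (p : F[X]) (d : ℕ) :
    (hilbertPoly p (d + 1)).coeff d = p.eval 1 / (d.factorial : F) := by
  rw [hilbertPoly_succ, finsetSum_coeff, eval_eq_sum, Polynomial.sum, Finset.sum_div]
  refine Finset.sum_congr rfl fun i _ => ?_
  rw [coeff_smul, coeff_preHilbertPoly_self, one_pow, mul_one, smul_eq_mul, div_eq_mul_inv]

section Numerator

variable {K M : Type*} [Field K] [AddCommGroup M] [Module K M] {𝓜 : ℕ → Submodule K M}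

/-- For large `n`, the iterated Hilbert function is given by a polynomial. -/
theorem IsHilbertNumerator.iteratedHilbertFunction_one_eq {F : Type*} [Field F] [CharZero F]
    {m : ℕ} {h : Polynomial ℤ} (hh : IsHilbertNumerator 𝓜 m h) {n : ℕ} (hn : h.natDegree < n) :
    (iteratedHilbertFunction 𝓜 1 n : F)
      = ((h.map (Int.castRingHom F)).hilbertPoly (m + 1)).eval (n : F) := by
  have key : ((h.map (Int.castRingHom F) : Polynomial F) : PowerSeries F)
      * PowerSeries.invOneSubPow F (m + 1)
      = PowerSeries.map (Int.castRingHom F) (hilbertSeries 𝓜) * PowerSeries.invOneSubPow F 1 := by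
    rw [Polynomial.polynomial_map_coe, hh, map_mul, map_pow, map_sub, map_one, PowerSeries.map_X,
      mul_assoc, add_comm m 1,
      PowerSeries.one_sub_pow_mul_invOneSubPow_val_add_eq_invOneSubPow_val]
  rw [← Polynomial.coeff_mul_invOneSubPow_eq_hilbertPoly_eval _
    (lt_of_le_of_lt Polynomial.natDegree_map_le hn), key, PowerSeries.coeff_mul,
    Finset.Nat.sum_antidiagonal_eq_sum_range_succ_mk, iteratedHilbertFunction, Nat.cast_sum]
  refine Finset.sum_congr rfl fun j _ => ?_
  rw [← zero_add 1, PowerSeries.invOneSubPow_val_succ_eq_mk_add_choose]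
  simp [hilbertSeries, iteratedHilbertFunction]

/-- If the Hilbert series is rational and the iterated Hilbert function is `O(n ^ m)`, then the
Hilbert series has a pole of order at most `m` at `1`. -/
theorem exists_isHilbertNumerator_of_le {m C N : ℕ}
    (hC : ∀ n, iteratedHilbertFunction 𝓜 1 n ≤ C * (n + 1) ^ m)
    {p : Polynomial ℤ} (hp : IsHilbertNumerator 𝓜 N p) :
    ∃ h : Polynomial ℤ, IsHilbertNumerator 𝓜 m h := by
  induction N generalizing p with
  | zero =>
    refine ⟨p * (1 - Polynomial.X) ^ m, ?_⟩
    rw [IsHilbertNumerator, pow_zero, mul_one] at hp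
    simp [IsHilbertNumerator, hp]
  | succ N ih =>
    by_cases hN : N + 1 ≤ m
    · obtain ⟨k, rfl⟩ := Nat.exists_eq_add_of_le hN
      refine ⟨p * (1 - Polynomial.X) ^ k, ?_⟩
      rw [IsHilbertNumerator] at hp ⊢
      rw [pow_add, ← mul_assoc, ← hp]
      simp
    -- Otherwise `P` has degree exactly `N + 1 > m`, and `P(n)` outgrows the bound `Q(n) = C (n + 1)
    -- ^ m`.
    · have h1 : p.IsRoot 1 := by
        by_contra hroot
        set P := (p.map (Int.castRingHom ℝ)).hilbertPoly (N + 1 + 1) with hP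
        have hcoeff : P.coeff (N + 1) ≠ 0 := by
          rw [hP, coeff_hilbertPoly_succ, ← map_one (Int.castRingHom ℝ), Polynomial.eval_map_apply]
          refine div_ne_zero ?_ (Nat.cast_ne_zero.2 (Nat.factorial_ne_zero _))
          simpa using hroot
        have hdeg : P.natDegree = N + 1 :=
          le_antisymm (natDegree_hilbertPoly_succ_le _ _) (Polynomial.le_natDegree_of_ne_zero hcoeff)
        let Q : Polynomial ℝ := Polynomial.C (C : ℝ) * (Polynomial.X + 1) ^ m
        have hQdeg : Q.degree < P.degree := by
          have : Q.natDegree ≤ m := by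
            simp only [Q]
            compute_degree
          have hP0 : P ≠ 0 := fun h => hcoeff (by simp [h])
          rw [Polynomial.degree_eq_natDegree hP0, hdeg]
          exact Polynomial.degree_le_natDegree.trans_lt (by exact_mod_cast by omega)
        have hlim := (Q.div_tendsto_atTop_zero_of_degree_lt P hQdeg).comp
          tendsto_natCast_atTop_atTop
        have hlt := hlim.eventually_lt_const (show (0 : ℝ) < 1 by norm_num)
        have hne : ∀ᶠ n : ℕ in Filter.atTop, P.eval (n : ℝ) ≠ 0 :=
          tendsto_natCast_atTop_atTop.eventually
            (P.eventually_atTop_not_isRoot fun h => hcoeff (by simp [h]))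
        obtain ⟨n, hn1, hn2, hn3⟩ :=
          (hlt.and (hne.and (Filter.eventually_gt_atTop p.natDegree))).exists
        have hval := hp.iteratedHilbertFunction_one_eq (F := ℝ) hn3
        rw [← hP] at hval
        have hpos : 0 < P.eval (n : ℝ) := by
          refine lt_of_le_of_ne ?_ hn2.symm
          rw [← hval]
          positivity
        have hle : P.eval (n : ℝ) ≤ Q.eval (n : ℝ) := by
          rw [← hval]
          simp only [Q, Polynomial.eval_mul, Polynomial.eval_C, Polynomial.eval_pow,
            Polynomial.eval_add, Polynomial.eval_X, Polynomial.eval_one]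
          exact_mod_cast hC n
        rw [Function.comp_apply, div_lt_one hpos] at hn1
        exact absurd hle (not_le.2 hn1)
      obtain ⟨q, hq⟩ := Polynomial.dvd_iff_isRoot.2 h1
      -- The sign comes from `p = (X - 1) q = (1 - X) (-q)`.
      refine ih (p := -q) ?_
      have hX : (1 - PowerSeries.X : PowerSeries ℤ) ≠ 0 := by
        intro h
        simpa using congrArg (PowerSeries.coeff 0) h
      apply mul_right_cancel₀ hX
      rw [IsHilbertNumerator, hq] at hp
      rw [mul_assoc, ← pow_succ, ← hp]
      simp
      ring

end Numerator

/-! ### Residues and the pole of the Riemann zeta function. -/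

open Filter Topology

/-- A simple pole contributes its coefficient to the residue. -/
theorem residue_eq_of_eventuallyEq {f G : ℂ → ℂ} {a c : ℂ} (hG : AnalyticAt ℂ G a)
    (hf : ∀ᶠ z in 𝓝[≠] a, f z = c * (z - a)⁻¹ + G z) : residue f a = c := by
  have hev := (eventually_nhdsWithin_iff.1 hf).and hG.eventually_analyticAt
  obtain ⟨ε, hε, hball⟩ := Metric.eventually_nhds_iff_ball.1 hev
  refine Tendsto.limUnder_eq (tendsto_const_nhds.congr' ?_)
  filter_upwards [Ioo_mem_nhdsGT hε] with r hr
  have hsub : Metric.closedBall a r ⊆ Metric.ball a ε := Metric.closedBall_subset_ball hr.2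
  have hne : ∀ z ∈ Metric.sphere a r, z ≠ a := fun z hz => Metric.ne_of_mem_sphere hz hr.1.ne'
  have hGd : DifferentiableOn ℂ G (Metric.closedBall a r) := fun z hz =>
    (hball z (hsub hz)).2.differentiableAt.differentiableWithinAt
  have hcongr : ∮ z in C(a, r), f z = ∮ z in C(a, r), (c * (z - a)⁻¹ + G z) :=
    circleIntegral.integral_congr hr.1.le fun z hz =>
      (hball z (hsub (Metric.sphere_subset_closedBall hz))).1 (hne z hz)
  have hint1 : CircleIntegrable (fun z => c * (z - a)⁻¹) a r := by
    refine ContinuousOn.circleIntegrable hr.1.le (continuousOn_const.mul ?_)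
    exact (continuousOn_id.sub continuousOn_const).inv₀ fun z hz => sub_ne_zero.2 (hne z hz)
  have hint2 : CircleIntegrable G a r :=
    ContinuousOn.circleIntegrable hr.1.le
      (hGd.continuousOn.mono Metric.sphere_subset_closedBall)
  have hzero : ∮ z in C(a, r), G z = 0 :=
    (hGd.mono Metric.closure_ball_subset_closedBall).diffContOnCl.circleIntegral_eq_zero hr.1.le
  rw [hcongr, circleIntegral.integral_add hint1 hint2, hzero, add_zero,
    circleIntegral.integral_const_mul,
    circleIntegral.integral_sub_inv_of_mem_ball (Metric.mem_ball_self hr.1)]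
  field_simp

/-- The singularity of `ζ(s) - 1 / (s - 1)` at `1` is removable; Euler's constant is the limit
there, hence the value that makes `g` continuous. -/
theorem exists_riemannZeta_eq_inv_add :
    ∃ g : ℂ → ℂ, AnalyticAt ℂ g 1 ∧ ∀ s ≠ 1, riemannZeta s = 1 * (s - 1)⁻¹ + g s := by
  set g : ℂ → ℂ := Function.update (fun s => riemannZeta s - 1 / (s - 1)) 1
    Real.eulerMascheroniConstant with hg
  have hgs : ∀ s ≠ 1, g s = riemannZeta s - 1 / (s - 1) := fun s hs => by
    simp [hg, Function.update_of_ne hs]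
  refine ⟨g, ?_, fun s hs => by rw [hgs s hs]; ring⟩
  refine Complex.analyticAt_of_differentiable_on_punctured_nhds_of_continuousAt ?_
    (continuousAt_update_same.2 tendsto_riemannZeta_sub_one_div)
  filter_upwards [self_mem_nhdsWithin] with s hs
  have hd : DifferentiableAt ℂ (fun s => riemannZeta s - 1 / (s - 1)) s :=
    (differentiableAt_riemannZeta hs).sub
      ((differentiableAt_const _).div (by fun_prop) (sub_ne_zero.2 hs))
  refine hd.congr_of_eventuallyEq ?_
  filter_upwards [isOpen_ne.mem_nhds hs] with t ht
  exact hgs t ht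

theorem analyticAt_riemannZeta {s : ℂ} (hs : s ≠ 1) : AnalyticAt ℂ riemannZeta s :=
  analyticOn_riemannZeta s hs

theorem meromorphicAt_riemannZeta (s : ℂ) : MeromorphicAt riemannZeta s := by
  by_cases hs : s = 1
  · subst hs
    obtain ⟨g, hg, h⟩ := exists_riemannZeta_eq_inv_add
    have : MeromorphicAt (fun s : ℂ => 1 * (s - 1)⁻¹ + g s) 1 := by
      have := hg.meromorphicAt
      fun_prop
    refine this.congr ?_
    filter_upwards [self_mem_nhdsWithin] with s hs
    exact (h s hs).symm
  · exact (analyticAt_riemannZeta hs).meromorphicAt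

/-! ### Uniqueness of the continuation. -/

section Uniqueness

variable {K M : Type*} [Field K] [AddCommGroup M] [Module K M] {𝓜 : ℕ → Submodule K M}

/-- The function `ζⁱ_M` is determined off a discrete set. -/
theorem IsHigherZeta.eventuallyEq {m i : ℕ} {Z Z' : ℂ → ℂ} (hZ : IsHigherZeta 𝓜 m i Z)
    (hZ' : IsHigherZeta 𝓜 m i Z') (a : ℂ) : Z =ᶠ[𝓝[≠] a] Z' := by
  have hmero : MeromorphicOn (Z - Z') Set.univ := hZ.meromorphic.sub hZ'.meromorphic
  have hzero : ∀ z : ℂ, (m : ℝ) + i < z.re → (Z - Z') z = 0 := fun z hz =>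
    sub_eq_zero.2 (tendsto_nhds_unique (hZ.tendsto z hz) (hZ'.tendsto z hz))
  -- A point of the half-plane where the difference vanishes locally; connectedness of `ℂ`
  -- propagates infinite order to every `a`.
  have htop : meromorphicOrderAt (Z - Z') ((m + i + 1 : ℝ) : ℂ) = ⊤ := by
    rw [meromorphicOrderAt_eq_top_iff]
    refine eventually_nhdsWithin_of_eventually_nhds ?_
    have hopen : IsOpen {z : ℂ | (m : ℝ) + i < z.re} :=
      isOpen_lt continuous_const Complex.continuous_re
    filter_upwards [hopen.mem_nhds (by simp)] with z hz
    exact hzero z hz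
  have ha : meromorphicOrderAt (Z - Z') a = ⊤ := by
    by_contra h
    exact hmero.meromorphicOrderAt_ne_top_of_isPreconnected isPreconnected_univ
      (Set.mem_univ a) (Set.mem_univ _) h htop
  filter_upwards [meromorphicOrderAt_eq_top_iff.1 ha] with z hz
  exact sub_eq_zero.1 hz

end Uniqueness

/-! ### Dirichlet series of eventually polynomial sequences. -/

section Series

/-- A majorant uniform in `w ≥ 0`, as dominated convergence for `w ↘ 0` requires. The index starts
at `1` because the zeroth term may blow up; `2 ^ m` comes from `n + 2 ≤ 2 (n + 1)`. -/
theorem norm_div_cpow_le {b : ℕ → ℂ} {m : ℕ} {C : ℝ} (hb : ∀ n, ‖b n‖ ≤ C * (n + 1) ^ m)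
    {z : ℂ} (hz : 0 ≤ z.re) {w : ℝ} (hw : 0 ≤ w) (n : ℕ) :
    ‖b (n + 1) / (((n + 1 : ℕ) : ℂ) + w) ^ z‖
      ≤ C * 2 ^ m * ((n + 1 : ℕ) : ℝ) ^ ((m : ℝ) - z.re) := by
  have hC : 0 ≤ C := by simpa using (norm_nonneg _).trans (hb 0)
  have hn : (0 : ℝ) < ((n + 1 : ℕ) : ℝ) := by positivity
  have hnw : (0 : ℝ) < ((n + 1 : ℕ) : ℝ) + w := by positivity
  have hcast : (((n + 1 : ℕ) : ℂ) + w) = ((((n + 1 : ℕ) : ℝ) + w : ℝ) : ℂ) := by push_cast; rfl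
  rw [norm_div, hcast, Complex.norm_cpow_eq_rpow_re_of_pos hnw, Real.rpow_sub hn,
    Real.rpow_natCast, ← mul_div_assoc]
  refine div_le_div₀ (by positivity) ?_ (by positivity)
    (Real.rpow_le_rpow hn.le (by linarith) hz)
  refine (hb (n + 1)).trans ?_
  rw [mul_assoc, ← mul_pow]
  gcongr
  push_cast
  linarith [(Nat.cast_nonneg n : (0 : ℝ) ≤ n)]

theorem summable_rpow_sub {m : ℕ} {x : ℝ} (hx : (m : ℝ) + 1 < x) (C : ℝ) :
    Summable fun n : ℕ => C * ((n + 1 : ℕ) : ℝ) ^ ((m : ℝ) - x) :=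
  ((summable_nat_add_iff 1).2 (Real.summable_nat_rpow.2 (by linarith))).mul_left C

theorem summable_div_cpow {b : ℕ → ℂ} {m : ℕ} {C : ℝ} (hb : ∀ n, ‖b n‖ ≤ C * (n + 1) ^ m)
    {z : ℂ} (hz : (m : ℝ) + 1 < z.re) {w : ℝ} (hw : 0 ≤ w) :
    Summable fun n : ℕ => b n / ((n : ℂ) + w) ^ z := by
  rw [← summable_nat_add_iff 1]
  exact Summable.of_norm_bounded (summable_rpow_sub hz _)
    (norm_div_cpow_le hb (by linarith [(Nat.cast_nonneg m : (0 : ℝ) ≤ m)]) hw)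

theorem tendsto_tsum_div_cpow {b : ℕ → ℂ} {m : ℕ} {C : ℝ} (hb : ∀ n, ‖b n‖ ≤ C * (n + 1) ^ m)
    {z : ℂ} (hz : (m : ℝ) + 1 < z.re) :
    Tendsto (fun w : ℝ => ∑' n : ℕ, b (n + 1) / (((n + 1 : ℕ) : ℂ) + w) ^ z) (𝓝[>] 0)
      (𝓝 (∑' n : ℕ, b (n + 1) / ((n + 1 : ℕ) : ℂ) ^ z)) := by
  refine tendsto_tsum_of_dominated_convergence (summable_rpow_sub hz (C * 2 ^ m)) ?_ ?_
  · intro n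
    have hcont : ContinuousAt (fun w : ℝ => b (n + 1) / (((n + 1 : ℕ) : ℂ) + w) ^ z) 0 := by
      have hslit : ((n + 1 : ℕ) : ℂ) + ((0 : ℝ) : ℂ) ∈ Complex.slitPlane := by
        left
        simp
        positivity
      refine continuousAt_const.div (ContinuousAt.cpow (by fun_prop) continuousAt_const hslit) ?_
      rw [Complex.cpow_ne_zero_iff]
      exact Or.inl (Complex.slitPlane_ne_zero hslit)
    simpa using hcont.tendsto.mono_left nhdsWithin_le_nhds
  · filter_upwards [self_mem_nhdsWithin] with w hw n
    exact norm_div_cpow_le hb (by linarith [(Nat.cast_nonneg m : (0 : ℝ) ≤ m)]) (le_of_lt hw) n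

/-- The continuation of the Dirichlet series `∑ b n / n ^ z` of a sequence which agrees with a
polynomial of degree at most `m` beyond `N`. -/
def polyZeta (b : ℕ → ℂ) (P : Polynomial ℂ) (m N : ℕ) (z : ℂ) : ℂ :=
  (∑ n ∈ Finset.range N, (b (n + 1) - P.eval ((n + 1 : ℕ) : ℂ)) / ((n + 1 : ℕ) : ℂ) ^ z)
    + ∑ k ∈ Finset.range (m + 1), P.coeff k * riemannZeta (z - k)

variable {b : ℕ → ℂ} {P : Polynomial ℂ} {m N : ℕ}

/-- Expand `P` in powers: `n ^ k / n ^ z` sums to `ζ(z - k)`, convergent because `k ≤ m`. The finite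
sum corrects the terms where `b` and `P` may differ. -/
theorem tsum_div_cpow_eq_polyZeta (hP : P.natDegree ≤ m)
    (hbP : ∀ n, N < n → b n = P.eval (n : ℂ)) {z : ℂ} (hz : (m : ℝ) + 1 < z.re) :
    ∑' n : ℕ, b (n + 1) / ((n + 1 : ℕ) : ℂ) ^ z = polyZeta b P m N z := by
  have h1 : HasSum (fun n : ℕ => (b (n + 1) - P.eval ((n + 1 : ℕ) : ℂ)) / ((n + 1 : ℕ) : ℂ) ^ z)
      (∑ n ∈ Finset.range N,
        (b (n + 1) - P.eval ((n + 1 : ℕ) : ℂ)) / ((n + 1 : ℕ) : ℂ) ^ z) := by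
    refine hasSum_sum_of_ne_finset_zero fun n hn => ?_
    rw [hbP (n + 1) (by simpa [Nat.lt_succ_iff] using hn), sub_self, zero_div]
  have h2 : ∀ k ∈ Finset.range (m + 1),
      HasSum (fun n : ℕ => P.coeff k * (1 / ((n + 1 : ℕ) : ℂ) ^ (z - k)))
        (P.coeff k * riemannZeta (z - k)) := by
    intro k hk
    have hk' : (k : ℝ) ≤ m := by exact_mod_cast Nat.lt_succ_iff.1 (Finset.mem_range.1 hk)
    have hre : 1 < (z - k).re := by simp; linarith
    have hs := (summable_nat_add_iff 1).2 (Complex.summable_one_div_nat_cpow.2 hre)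
    rw [zeta_eq_tsum_one_div_nat_add_one_cpow hre]
    simpa using hs.hasSum.mul_left (P.coeff k)
  rw [polyZeta, ← (h1.add (hasSum_sum h2)).tsum_eq]
  refine tsum_congr fun n => ?_
  have hn : ((n + 1 : ℕ) : ℂ) ≠ 0 := Nat.cast_ne_zero.2 n.succ_ne_zero
  have h3 : ∀ k : ℕ, P.coeff k * (1 / ((n + 1 : ℕ) : ℂ) ^ (z - k))
      = P.coeff k * ((n + 1 : ℕ) : ℂ) ^ k / ((n + 1 : ℕ) : ℂ) ^ z := fun k => by
    rw [Complex.cpow_sub _ _ hn, Complex.cpow_natCast, one_div_div, mul_div_assoc]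
  simp_rw [h3]
  rw [← Finset.sum_div, ← Polynomial.eval_eq_sum_range' (Nat.lt_succ_of_le hP), ← add_div,
    sub_add_cancel]

theorem meromorphicAt_riemannZeta_sub (k z : ℂ) :
    MeromorphicAt (fun z => riemannZeta (z - k)) z :=
  MeromorphicAt.comp_analyticAt (g := fun z => z - k) (meromorphicAt_riemannZeta (z - k))
    (by fun_prop)

theorem analyticAt_nat_cpow_sum (b : ℕ → ℂ) (P : Polynomial ℂ) (N : ℕ) (z : ℂ) :
    AnalyticAt ℂ (fun z => ∑ n ∈ Finset.range N,
      (b (n + 1) - P.eval ((n + 1 : ℕ) : ℂ)) / ((n + 1 : ℕ) : ℂ) ^ z) z := by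
  refine Finset.analyticAt_fun_sum _ fun n _ => analyticAt_const.div ?_ ?_
  · exact analyticAt_const.cpow analyticAt_id (Or.inl (by simp; positivity))
  · rw [Complex.cpow_ne_zero_iff]
    exact Or.inl (Nat.cast_ne_zero.2 n.succ_ne_zero)

theorem meromorphicOn_polyZeta : MeromorphicOn (polyZeta b P m N) Set.univ := by
  intro z _
  refine (analyticAt_nat_cpow_sum b P N z).meromorphicAt.add ?_
  refine MeromorphicAt.fun_sum fun k _ => (MeromorphicAt.const _ _).mul ?_
  exact meromorphicAt_riemannZeta_sub k z

/-- The principal part of the continuation at `m + 1`. -/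
theorem exists_polyZeta_eq :
    ∃ G : ℂ → ℂ, AnalyticAt ℂ G (m + 1) ∧ ∀ z ≠ (m : ℂ) + 1,
      polyZeta b P m N z = P.coeff m * (z - (m + 1))⁻¹ + G z := by
  obtain ⟨g, hg, h⟩ := exists_riemannZeta_eq_inv_add
  -- For `k < m` the argument `m + 1 - k` is not `1`, so only the summand `k = m` is singular at `m
  -- + 1`.
  refine ⟨fun z => (∑ n ∈ Finset.range N,
      (b (n + 1) - P.eval ((n + 1 : ℕ) : ℂ)) / ((n + 1 : ℕ) : ℂ) ^ z)
      + ((∑ k ∈ Finset.range m, P.coeff k * riemannZeta (z - k)) + P.coeff m * g (z - m)), ?_, ?_⟩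
  · refine (analyticAt_nat_cpow_sum b P N _).add (AnalyticAt.add ?_ (analyticAt_const.mul ?_))
    · refine Finset.analyticAt_fun_sum _ fun k hk => analyticAt_const.mul ?_
      refine AnalyticAt.fun_comp (analyticAt_riemannZeta fun h => ?_) (by fun_prop)
      have : (m : ℂ) = k := by linear_combination h
      exact (Finset.mem_range.1 hk).ne' (by exact_mod_cast this)
    · refine AnalyticAt.fun_comp ?_ (by fun_prop)
      simpa using hg
  · intro z hz
    have hz' : z - m ≠ 1 := fun h => hz (by linear_combination h)
    rw [polyZeta, Finset.sum_range_succ, h _ hz']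
    ring

end Series

/-! ### The zeta function of the iterated Hilbert function. -/

section HigherZeta

variable {K M : Type*} [Field K] [AddCommGroup M] [Module K M] {𝓜 : ℕ → Submodule K M} {m C : ℕ}

theorem norm_iteratedHilbertFunction_le
    (hC : ∀ n, iteratedHilbertFunction 𝓜 1 n ≤ C * (n + 1) ^ m) (n : ℕ) :
    ‖(iteratedHilbertFunction 𝓜 1 n : ℂ)‖ ≤ (C : ℝ) * (n + 1) ^ m := by
  rw [Complex.norm_natCast]
  exact_mod_cast hC n

theorem summable_zetaBarnesTerm (hC : ∀ n, iteratedHilbertFunction 𝓜 1 n ≤ C * (n + 1) ^ m)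
    {z : ℂ} {w : ℝ} (hz : (m : ℝ) + 1 < z.re) (hw : 0 ≤ w) :
    Summable (zetaBarnesTerm 𝓜 1 z w) :=
  summable_div_cpow (norm_iteratedHilbertFunction_le hC) hz hw

/-- The first term of the series is the one that is subtracted. -/
theorem zetaBarnesSeries_sub_eq (hC : ∀ n, iteratedHilbertFunction 𝓜 1 n ≤ C * (n + 1) ^ m)
    {z : ℂ} {w : ℝ} (hz : (m : ℝ) + 1 < z.re) (hw : 0 ≤ w) :
    zetaBarnesSeries 𝓜 1 z w - (hilbertFunction 𝓜 0 : ℂ) * (w : ℂ) ^ (-z)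
      = ∑' n : ℕ, (iteratedHilbertFunction 𝓜 1 (n + 1) : ℂ) / (((n + 1 : ℕ) : ℂ) + w) ^ z := by
  rw [zetaBarnesSeries, (summable_zetaBarnesTerm hC hz hw).tsum_eq_zero_add]
  have h0 : zetaBarnesTerm 𝓜 1 z w 0 = (hilbertFunction 𝓜 0 : ℂ) * (w : ℂ) ^ (-z) := by
    simp [zetaBarnesTerm, iteratedHilbertFunction, Complex.cpow_neg, div_eq_mul_inv]
  rw [h0, add_sub_cancel_left]
  rfl

theorem isHigherZeta_polyZeta (hC : ∀ n, iteratedHilbertFunction 𝓜 1 n ≤ C * (n + 1) ^ m)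
    {P : Polynomial ℂ} {N : ℕ} (hP : P.natDegree ≤ m)
    (hN : ∀ n, N < n → (iteratedHilbertFunction 𝓜 1 n : ℂ) = P.eval (n : ℂ)) :
    IsHigherZeta 𝓜 m 1 (polyZeta (fun n => (iteratedHilbertFunction 𝓜 1 n : ℂ)) P m N) where
  meromorphic := meromorphicOn_polyZeta
  tendsto z hz := by
    rw [Nat.cast_one] at hz
    rw [← tsum_div_cpow_eq_polyZeta hP hN hz]
    refine (tendsto_tsum_div_cpow (norm_iteratedHilbertFunction_le hC) hz).congr' ?_
    filter_upwards [self_mem_nhdsWithin] with w hw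
    exact (zetaBarnesSeries_sub_eq hC hz (le_of_lt hw)).symm

theorem isHigherZeta_higherZeta {i : ℕ} {Z : ℂ → ℂ} (hZ : IsHigherZeta 𝓜 m i Z) :
    IsHigherZeta 𝓜 m i (higherZeta 𝓜 m i) := by
  have h : ∃ Z : ℂ → ℂ, IsHigherZeta 𝓜 m i Z := ⟨Z, hZ⟩
  rw [higherZeta, dif_pos h]
  exact h.choose_spec

theorem isHilbertNumerator_hilbertNumerator {h : Polynomial ℤ} (hh : IsHilbertNumerator 𝓜 m h) :
    IsHilbertNumerator 𝓜 m (hilbertNumerator 𝓜 m) := by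
  have h : ∃ h : Polynomial ℤ, IsHilbertNumerator 𝓜 m h := ⟨h, hh⟩
  rw [hilbertNumerator, dif_pos h]
  exact h.choose_spec

end HigherZeta

end GradedZeta

end

/-- Let `S` be a standard graded `K`-algebra and `M ≠ 0` a finitely generated graded `S`-module of
Krull dimension `m`. Then `e(M) = m! R¹_M(m + 1)`. The first three conjuncts say that the objects in
this formula are what they should be: `h_M` is the numerator of the Hilbert series, the series
`ζ¹_M(z, w)` converge absolutely for `Re z > m + 1`, and `ζ¹_M` extends meromorphically to `ℂ`. -/
theorem corollary3p5 {K S M : Type*} [Field K] [CommRing S] [Algebra K S]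
    (𝒮 : ℕ → Submodule K S) [GradedAlgebra 𝒮] (h𝒮 : GradedZeta.IsStandardGraded 𝒮)
    [AddCommGroup M] [Module K M] [Module S M] [IsScalarTower K S M]
    (𝓜 : ℕ → Submodule K M) [DirectSum.Decomposition 𝓜] [SetLike.GradedSMul 𝒮 𝓜]
    [Module.Finite S M] [Nontrivial M]
    (m : ℕ) (hm : Module.supportDim S M = (m : WithBot ℕ∞)) :
    GradedZeta.IsHilbertNumerator 𝓜 m (GradedZeta.hilbertNumerator 𝓜 m) ∧
    (∀ (z : ℂ) (w : ℝ), (m : ℝ) + 1 < z.re → 0 < w →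
      Summable (GradedZeta.zetaBarnesTerm 𝓜 1 z w)) ∧
    GradedZeta.IsHigherZeta 𝓜 m 1 (GradedZeta.higherZeta 𝓜 m 1) ∧
    (GradedZeta.multiplicity 𝓜 m : ℂ)
      = (Nat.factorial m : ℂ) * GradedZeta.higherZetaResidue 𝓜 m 1 ((m : ℂ) + 1) := by
  obtain ⟨hfin, C, hC⟩ := GradedZeta.exists_finiteDimensional_and_le 𝓜 h𝒮 hm.le
  obtain ⟨N, p, hp⟩ := GradedZeta.exists_isHilbertNumerator h𝒮 𝓜
  obtain ⟨h₀, hh₀⟩ := GradedZeta.exists_isHilbertNumerator_of_le hC hp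
  have hh := GradedZeta.isHilbertNumerator_hilbertNumerator hh₀
  set h := GradedZeta.hilbertNumerator 𝓜 m with h_def
  have hZ := GradedZeta.isHigherZeta_polyZeta hC
    (GradedZeta.natDegree_hilbertPoly_succ_le (h.map (Int.castRingHom ℂ)) m)
    (fun n hn => hh.iteratedHilbertFunction_one_eq hn)
  have hZ' := GradedZeta.isHigherZeta_higherZeta hZ
  refine ⟨hh, fun z w hz hw => GradedZeta.summable_zetaBarnesTerm hC hz hw.le, hZ', ?_⟩
  obtain ⟨G, hG, hpole⟩ := GradedZeta.exists_polyZeta_eq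
    (b := fun n => (GradedZeta.iteratedHilbertFunction 𝓜 1 n : ℂ))
    (P := (h.map (Int.castRingHom ℂ)).hilbertPoly (m + 1)) (m := m) (N := h.natDegree)
  -- The chosen `higherZeta` is known to equal the explicit continuation only on a punctured
  -- neighbourhood of `m + 1`, which is enough for the residue.
  have hres := GradedZeta.residue_eq_of_eventuallyEq (f := GradedZeta.higherZeta 𝓜 m 1) hG (by
    filter_upwards [hZ'.eventuallyEq hZ ((m : ℂ) + 1), self_mem_nhdsWithin] with z hz hne
    rw [hz, hpole z hne])
  rw [GradedZeta.higherZetaResidue, hres, GradedZeta.coeff_hilbertPoly_succ,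
    mul_div_cancel₀ _ (Nat.cast_ne_zero.2 (Nat.factorial_ne_zero m)),
    GradedZeta.multiplicity, ← map_one (Int.castRingHom ℂ), Polynomial.eval_map_apply]
  rfl
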